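/- Let $m\ge 2$ be an integer and $\theta\in\mathbb R$ with $\sin\theta\neq 0$, and let $\jmath=\sqrt{-1}$. Let $Q=\begin{pmatrix}\cos\theta&\sin\theta\\-\sin\theta&\cos\theta\end{pmatrix}$ and let $A\in\mathbb R^{2m\times 2m}$ be the real Jordan block consisting of $m\times m$ blocks of size $2\times2$, with $Q$ in the diagonal blocks, $I_2$ in the blocks directly above the diagonal, and $0$ elsewhere. For real constants $c_1,\dots,c_{2m}$ and $\varepsilon>0$ let $K\in\mathbb R^{2m\times 2m}$ be the matrix whose last row is $[k_1,k_2,\dots,k_{2m}]$ and whose other rows are zero, where $$k_{2j-1}=c_{2j-1}\varepsilon^{m-j},\quad k_{2j}=c_{2j}\varepsilon^{m-j}\quad(1\le j\le m-1),\qquad k_{2m-1}=c_{2m-1}\varepsilon,\quad k_{2m}=c_{2m}\varepsilon .$$ For $\lambda_i>0$ put $A_i=A-\lambda_iK$ and let $\rho_i$ be the spectral radius of $A_i$. Put $$R_m=\tfrac12+\tfrac12\,(c_{2m-1}\sin\theta-c_{2m}\cos\theta),\qquad H=\mathrm{Re}\Big[\frac{c_{2m-5}\jmath-c_{2m-4}}{c_{2m-3}\jmath-c_{2m-2}}\,e^{-\jmath\theta}\Big]\quad(m\ge3).$$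 Consider the following requirements on the constants. 1) If $m=2$: $c_1=-\sin2\theta$, $c_2=\cos2\theta$ and $R_2<0$. 2) If $m\ge3$: $c_{2m-3}=-\sin2\theta$, $c_{2m-2}=\cos2\theta$; the equation $$\vartheta^{m-2}(c_{2m-2}-c_{2m-3}\jmath)+\cdots+\vartheta(c_4-c_3\jmath)+(c_2-c_1\jmath)=0$$ has $m-2$ distinct roots $\vartheta_{n1}$, $n=3,\dots,m$; $\lambda_iR_m+H<0$; and $\mathrm{Re}(\vartheta_{n1}e^{-\jmath\theta})<0$ for $n=3,\dots,m$. Then the following hold. (a) For any $\lambda_1,\dots,\lambda_N>0$ there are constants $c_1,\dots,c_{2m}$ (the same for all $i$) which satisfy these requirements for every $i$ and such that, for all sufficiently small $\varepsilon>0$ and every $i$, $\rho_i<1$ and $A_i$ has $2m$ distinct eigenvalues. (b) Whenever $\lambda_i>0$ and the constants satisfy the requirements for this $\lambda_i$, then for all sufficiently small $\varepsilon>0$ we have $\rho_i<1$ and $A_i$ has $2m$ distinct eigenvalues; moreover, as $\varepsilon\to0^+$, $$\rho_i=1+\tfrac12\lambda_iR_2\,\varepsilon+o(\varepsilon)\quad\text{if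 } m=2,$$ $$\rho_i=1+\tfrac12\max_{n=3,\dots,m}\{\lambda_iR_m+H,\;2\,\mathrm{Re}(\vartheta_{n1}e^{-\jmath\theta})\}\,\varepsilon+o(\varepsilon)\quad\text{if } m\ge3.$$ -/

import Mathlib

open Filter Topology Asymptotics

noncomputable section

namespace Oscillator

/-- The `2 × 2` rotation block `Q`. -/
def Q (θ : ℝ) : Matrix (Fin 2) (Fin 2) ℝ :=
  !![Real.cos θ, Real.sin θ; -Real.sin θ, Real.cos θ]

/-- The `2m × 2m` real Jordan block: `Q` on the diagonal blocks, `I₂` on the first block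
superdiagonal. The pair `(p, a)` (both counted from `0`) is the coordinate `2 p + a + 1`
of `ℝ^{2m}`. -/
def A (m : ℕ) (θ : ℝ) : Matrix (Fin m × Fin 2) (Fin m × Fin 2) ℝ :=
  Matrix.of fun x y =>
    if x.1 = y.1 then Q θ x.2 y.2
    else if (x.1 : ℕ) + 1 = (y.1 : ℕ) then (1 : Matrix (Fin 2) (Fin 2) ℝ) x.2 y.2
    else 0

/-- The matrix whose last row is `[k 1, k 2, …, k (2m)]` and whose other rows vanish. -/
def K (m : ℕ) (k : ℕ → ℝ) : Matrix (Fin m × Fin 2) (Fin m × Fin 2) ℝ :=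
  Matrix.of fun x y =>
    if (x.1 : ℕ) + 1 = m ∧ x.2 = 1 then k (2 * (y.1 : ℕ) + (y.2 : ℕ) + 1) else 0

/-- The scaled gains `k 1, …, k (2m)`: for `i = 2j - 1` and for `i = 2j` (so that
`j = (i + 1) / 2`), the gain `k i` is `c i * ε ^ (m - j)` when `j ≤ m - 1`, and it is
`c i * ε` when `j = m`. -/
def gain (m : ℕ) (c : ℕ → ℝ) (ε : ℝ) (i : ℕ) : ℝ :=
  if (i + 1) / 2 < m then c i * ε ^ (m - (i + 1) / 2) else c i * ε

/-- The matrix `A - lam K` with the scaled gains, as a complex matrix. -/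
def closedLoop (m : ℕ) (θ lam : ℝ) (c : ℕ → ℝ) (ε : ℝ) :
    Matrix (Fin m × Fin 2) (Fin m × Fin 2) ℂ :=
  (A m θ - lam • K m (gain m c ε)).map Complex.ofReal

/-- The spectral radius of `A - lam K`, i.e. the largest modulus of a complex eigenvalue. -/
def rho (m : ℕ) (θ lam : ℝ) (c : ℕ → ℝ) (ε : ℝ) : ENNReal :=
  spectralRadius ℂ (closedLoop m θ lam c ε)

/-- The spectral radius is below `1` and the `2m` eigenvalues are pairwise distinct. -/
def StableDistinct (m : ℕ) (θ lam : ℝ) (c : ℕ → ℝ) (ε : ℝ) : Prop :=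
  rho m θ lam c ε < 1 ∧ (spectrum ℂ (closedLoop m θ lam c ε)).ncard = 2 * m

/-- The constant `R_m`. -/
def R (m : ℕ) (θ : ℝ) (c : ℕ → ℝ) : ℝ :=
  1 / 2 + 1 / 2 * (c (2 * m - 1) * Real.sin θ - c (2 * m) * Real.cos θ)

/-- The constant `H`, used for `m ≥ 3` only. -/
def H (m : ℕ) (θ : ℝ) (c : ℕ → ℝ) : ℝ :=
  (((c (2 * m - 5) : ℂ) * Complex.I - (c (2 * m - 4) : ℂ)) /
    ((c (2 * m - 3) : ℂ) * Complex.I - (c (2 * m - 2) : ℂ)) *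
      Complex.exp (-(θ * Complex.I))).re

/-- The left-hand side of the auxiliary equation
`z ^ (m-2) (c (2m-2) - c (2m-3) i) + ⋯ + z (c 4 - c 3 i) + (c 2 - c 1 i) = 0`. -/
def aux (m : ℕ) (c : ℕ → ℝ) (z : ℂ) : ℂ :=
  ∑ j ∈ Finset.Icc 1 (m - 1),
    z ^ (j - 1) * ((c (2 * j) : ℂ) - (c (2 * j - 1) : ℂ) * Complex.I)

/-- The requirements on the constants for `m = 2`. -/
def CondTwo (θ : ℝ) (c : ℕ → ℝ) : Prop :=
  c 1 = -Real.sin (2 * θ) ∧ c 2 = Real.cos (2 * θ) ∧ R 2 θ c < 0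

/-- The requirements on the constants for `m ≥ 3`; `ϑ 3, …, ϑ m` are the `m - 2` distinct
roots of the auxiliary equation, which has degree `m - 2`. -/
def CondGeThree (m : ℕ) (θ lam : ℝ) (c : ℕ → ℝ) (ϑ : ℕ → ℂ) : Prop :=
  c (2 * m - 3) = -Real.sin (2 * θ) ∧ c (2 * m - 2) = Real.cos (2 * θ) ∧
  Set.InjOn ϑ (Set.Icc 3 m) ∧
  (∀ n ∈ Set.Icc 3 m, aux m c (ϑ n) = 0) ∧
  lam * R m θ c + H m θ c < 0 ∧
  ∀ n ∈ Set.Icc 3 m, (ϑ n * Complex.exp (-(θ * Complex.I))).re < 0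

end Oscillator

end

noncomputable section

namespace Oscillator

/-! Write `a` for e^{iθ}, γ_p for the complex gain of block p, m = k + 2, u = z - a and v = z -
e^{-iθ}. In the basis (1, i), (1, -i) the block Q is diagonal, and solving the eigenvector equation
block by block leaves one scalar equation, `charFun` = 0. Only one direction is needed: each zero is
an eigenvalue. Near z = a the zeros live on two scales. With u = εw the terms of order ε^{k+1} leave
Σ_{p ≤ k} γ_p w^p = 0, which is the auxiliary equation and gives k zeros. With u = aδ(s + δw), δ =
√ε, the balance of u^{k+2} against the gain γ_k = i a² gives s² = -λ/2, and the next order fixes the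
limit t of w; this gives two more zeros. `exists_tendsto_zero`, a Hurwitz-type argument, turns these
formal limits into actual zeros. All k + 2 = m zeros have the form a(1 + iσδ + Tδ² + o(δ²)) with σ
real and distinct pairs (σ, T). With their conjugates they are 2m distinct eigenvalues, so they
exhaust the spectrum. Their moduli are 1 + (Re T + σ²/2)ε + o(ε); the largest coefficient governs
the spectral radius, and its real parts are expressed by R, H and the roots ϑ. For existence, the
γ_p with p ≤ k are the coefficients of a polynomial with prescribed stable roots. This fixes H,
while the last block remains free to make R as negative as needed. -/

/-- The complex gain `c (2p+1) + c (2p+2) i` of the block `p`, counted from `0`. -/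
def blockGain (c : ℕ → ℝ) (p : ℕ) : ℂ := (c (2 * p + 1) : ℂ) + (c (2 * p + 2) : ℂ) * Complex.I

/-- The power of `ε` that scales the gains of the block `p`, counted from `0`. -/
def scale (m : ℕ) (ε : ℝ) (p : ℕ) : ℝ := if p + 1 < m then ε ^ (m - (p + 1)) else ε

/-- The eigenvalue `e^{iθ}` of the rotation block. -/
def rot (θ : ℝ) : ℂ := Complex.exp (θ * Complex.I)

/-- The characteristic function of the closed loop, in the coordinates that diagonalize the
rotation block. -/
def charFun (m : ℕ) (θ lam : ℝ) (c : ℕ → ℝ) (ε : ℝ) (z : ℂ) : ℂ :=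
  (z - rot θ) ^ m * (z - rot (-θ)) ^ m + lam / (2 * Complex.I) *
    ((z - rot (-θ)) ^ m * ∑ p ∈ Finset.range m, blockGain c p * scale m ε p * (z - rot θ) ^ p -
      (z - rot θ) ^ m * ∑ p ∈ Finset.range m,
        (starRingEnd ℂ) (blockGain c p) * scale m ε p * (z - rot (-θ)) ^ p)

/-! ### Rotation eigenvalues and conjugation symmetry. -/

lemma rot_eq (θ : ℝ) : rot θ = (Real.cos θ : ℂ) + (Real.sin θ : ℂ) * Complex.I := by
  simp [rot, Complex.exp_mul_I]

lemma rot_neg_eq (θ : ℝ) : rot (-θ) = (Real.cos θ : ℂ) - (Real.sin θ : ℂ) * Complex.I := by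
  rw [rot_eq]; simp; ring

lemma rot_mul_rot_neg (θ : ℝ) : rot θ * rot (-θ) = 1 := by
  rw [rot, rot, ← Complex.exp_add]; simp

lemma norm_rot (θ : ℝ) : ‖rot θ‖ = 1 := Complex.norm_exp_ofReal_mul_I θ

lemma rot_ne_zero (θ : ℝ) : rot θ ≠ 0 := Complex.exp_ne_zero _

lemma conj_rot (θ : ℝ) : (starRingEnd ℂ) (rot θ) = rot (-θ) := by
  rw [rot_eq, rot_neg_eq]; simp [-Complex.ofReal_cos, -Complex.ofReal_sin, sub_eq_add_neg]

lemma rot_sub_rot_neg (θ : ℝ) : rot θ - rot (-θ) = 2 * Complex.I * Real.sin θ := by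
  rw [rot_eq, rot_neg_eq]; ring

lemma rot_sub_rot_neg_ne_zero {θ : ℝ} (hθ : Real.sin θ ≠ 0) : rot θ - rot (-θ) ≠ 0 := by
  rw [rot_sub_rot_neg]
  exact mul_ne_zero (mul_ne_zero two_ne_zero Complex.I_ne_zero) (by exact_mod_cast hθ)

lemma gain_eq (m : ℕ) (c : ℕ → ℝ) (ε : ℝ) (p : ℕ) (i : Fin 2) :
    gain m c ε (2 * p + (i : ℕ) + 1) = c (2 * p + (i : ℕ) + 1) * scale m ε p := by
  have h : (2 * p + (i : ℕ) + 1 + 1) / 2 = p + 1 := by omega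
  simp only [gain, scale, h]
  split_ifs <;> rfl

/-- Conjugation exchanges the two sums and reverses the sign of 1/(2i), so the two effects cancel.
-/
lemma conj_charFun (m : ℕ) (θ lam : ℝ) (c : ℕ → ℝ) (ε : ℝ) (z : ℂ) :
    charFun m θ lam c ε ((starRingEnd ℂ) z) = (starRingEnd ℂ) (charFun m θ lam c ε z) := by
  simp only [charFun, map_add, map_mul, map_sub, map_pow, map_div₀, map_sum, conj_rot, neg_neg,
    Complex.conj_I, Complex.conj_ofReal, map_ofNat, Complex.conj_conj]
  rw [show (lam : ℂ) / (2 * -Complex.I) = -(lam / (2 * Complex.I)) by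
    rw [mul_neg, div_neg]]
  ring

/-! ### Eigenvectors of the closed loop. -/

/-- The candidate eigenvector for the eigenvalue `z`. -/
def eigenvec (m : ℕ) (u v : ℂ) : Fin m × Fin 2 → ℂ := fun x =>
  v ^ m * u ^ (x.1 : ℕ) * ![1, Complex.I] x.2 - u ^ m * v ^ (x.1 : ℕ) * ![1, -Complex.I] x.2

lemma eigenvec_ne_zero {m : ℕ} (hm : 0 < m) {u v : ℂ} (huv : u ≠ v) : eigenvec m u v ≠ 0 := by
  intro h
  have h0 := congrFun h (⟨0, hm⟩, 0)
  have h1 := congrFun h (⟨0, hm⟩, 1)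
  simp [eigenvec] at h0 h1
  have h1' : Complex.I * (v ^ m + u ^ m) = 0 := by linear_combination h1
  have h2 : v ^ m + u ^ m = 0 := (mul_eq_zero.mp h1').resolve_left Complex.I_ne_zero
  have hv : v ^ m = 0 := by linear_combination (h0 + h2) / 2
  have hu : u ^ m = 0 := by linear_combination (h2 - h0) / 2
  exact huv ((pow_eq_zero_iff hm.ne').mp hu |>.trans ((pow_eq_zero_iff hm.ne').mp hv).symm)

/-- The chains u^p (1, i) and v^p (1, -i) satisfy the eigenvector equation in every block but the
last, where they miss the terms u^m (1, i) and v^m (1, -i). The weights v^m and u^m make the first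
coordinates of these defects cancel, so what remains lies in the last coordinate, the only one that
`K` reaches. -/
lemma A_mulVec_eigenvec {m : ℕ} (θ : ℝ) (z : ℂ) (p : Fin m) (i : Fin 2) :
    ∑ y, (A m θ (p, i) y : ℂ) * eigenvec m (z - rot θ) (z - rot (-θ)) y =
      z * eigenvec m (z - rot θ) (z - rot (-θ)) (p, i) -
        if (p : ℕ) + 1 = m ∧ i = 1 then
          2 * Complex.I * ((z - rot θ) ^ m * (z - rot (-θ)) ^ m) else 0 := by
  set u := z - rot θ with hu
  set v := z - rot (-θ) with hv
  have hz : z = u + rot θ := by rw [hu]; ring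
  have hz' : z = v + rot (-θ) := by rw [hv]; ring
  have key : ∀ q j, (A m θ (p, i) (q, j) : ℂ) * eigenvec m u v (q, j) =
      (if p = q then (Q θ i j : ℂ) * eigenvec m u v (q, j) else 0) +
        (if (p : ℕ) + 1 = q then
          ((1 : Matrix (Fin 2) (Fin 2) ℝ) i j : ℂ) * eigenvec m u v (q, j) else 0) := by
    intro q j
    by_cases hpq : p = q
    · subst hpq; simp [A]
    · by_cases h2 : (p : ℕ) + 1 = q <;> simp [A, hpq, h2]
  rw [Fintype.sum_prod_type]
  simp only [key, Finset.sum_add_distrib, Fin.sum_univ_two, Finset.sum_ite_eq, Finset.mem_univ,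
    if_true]
  have hQ : (Q θ i 0 : ℂ) * eigenvec m u v (p, 0) + (Q θ i 1 : ℂ) * eigenvec m u v (p, 1) =
      z * eigenvec m u v (p, i) -
        (v ^ m * u ^ ((p : ℕ) + 1) * ![1, Complex.I] i -
          u ^ m * v ^ ((p : ℕ) + 1) * ![1, -Complex.I] i) := by
    have I2 := Complex.I_sq
    rw [rot_eq] at hz
    rw [rot_neg_eq] at hz'
    fin_cases i
    · simp [Q, eigenvec, -Complex.ofReal_cos, -Complex.ofReal_sin]
      linear_combination -(v ^ m * u ^ (p : ℕ)) * hz + u ^ m * v ^ (p : ℕ) * hz'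
    · simp [Q, eigenvec, -Complex.ofReal_cos, -Complex.ofReal_sin]
      linear_combination -(Complex.I * v ^ m * u ^ (p : ℕ)) * hz -
        Complex.I * u ^ m * v ^ (p : ℕ) * hz' +
        (Real.sin θ : ℂ) * (u ^ m * v ^ (p : ℕ) - v ^ m * u ^ (p : ℕ)) * I2
  have hshift : (∑ q : Fin m, if (p : ℕ) + 1 = q then
        ((1 : Matrix (Fin 2) (Fin 2) ℝ) i 0 : ℂ) * eigenvec m u v (q, 0) else 0) +
      (∑ q : Fin m, if (p : ℕ) + 1 = q then
        ((1 : Matrix (Fin 2) (Fin 2) ℝ) i 1 : ℂ) * eigenvec m u v (q, 1) else 0) =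
      (v ^ m * u ^ ((p : ℕ) + 1) * ![1, Complex.I] i -
          u ^ m * v ^ ((p : ℕ) + 1) * ![1, -Complex.I] i) -
        if (p : ℕ) + 1 = m ∧ i = 1 then 2 * Complex.I * (u ^ m * v ^ m) else 0 := by
    by_cases hp : (p : ℕ) + 1 = m
    · have hne : ∀ q : Fin m, ¬ ((p : ℕ) + 1 = q) := fun q => by have := q.2; omega
      simp only [hne, if_false, Finset.sum_const_zero]
      fin_cases i <;> simp [hp] <;> ring
    · have hiff : ∀ q : Fin m, (p : ℕ) + 1 = q ↔ (⟨p + 1, by omega⟩ : Fin m) = q := fun q => by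
        simp [Fin.ext_iff]
      simp only [hiff, Finset.sum_ite_eq, Finset.mem_univ, if_true, hp, false_and, if_false]
      obtain rfl | rfl : i = 0 ∨ i = 1 := by omega
      all_goals simp [eigenvec]
  linear_combination hQ + hshift

/-- Zeros of the characteristic function are eigenvalues of the closed loop. -/
theorem mem_spectrum_of_charFun_eq_zero {m : ℕ} (hm : 0 < m) {θ : ℝ} (hθ : Real.sin θ ≠ 0)
    {lam : ℝ} {c : ℕ → ℝ} {ε : ℝ} {z : ℂ} (hz : charFun m θ lam c ε z = 0) :
    z ∈ spectrum ℂ (closedLoop m θ lam c ε) := by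
  rw [spectrum.mem_iff, Matrix.isUnit_iff_isUnit_det, isUnit_iff_ne_zero, not_not,
    ← Matrix.exists_mulVec_eq_zero_iff]
  refine ⟨eigenvec m (z - rot θ) (z - rot (-θ)), eigenvec_ne_zero hm ?_, ?_⟩
  · intro h
    exact rot_sub_rot_neg_ne_zero hθ (by linear_combination -h)
  · ext ⟨p, i⟩
    rw [Matrix.sub_mulVec, Pi.sub_apply, Algebra.algebraMap_eq_smul_one, Matrix.smul_mulVec,
      Matrix.one_mulVec]
    have hK : ∑ y, (K m (gain m c ε) (p, i) y : ℂ) *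
        eigenvec m (z - rot θ) (z - rot (-θ)) y = if (p : ℕ) + 1 = m ∧ i = 1 then
          (z - rot (-θ)) ^ m *
            ∑ p ∈ Finset.range m, blockGain c p * scale m ε p * (z - rot θ) ^ p -
          (z - rot θ) ^ m * ∑ p ∈ Finset.range m,
            (starRingEnd ℂ) (blockGain c p) * scale m ε p * (z - rot (-θ)) ^ p else 0 := by
      by_cases h : (p : ℕ) + 1 = m ∧ i = 1
      · simp only [K, Matrix.of_apply, if_pos h, gain_eq]
        rw [Fintype.sum_prod_type, Finset.sum_range, Finset.sum_range, Finset.mul_sum,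
          Finset.mul_sum, ← Finset.sum_sub_distrib]
        refine Finset.sum_congr rfl fun q _ => ?_
        simp [Fin.sum_univ_two, eigenvec, blockGain]
        ring
      · simp [K, h]
    have hA := A_mulVec_eigenvec θ z p i
    have : (closedLoop m θ lam c ε).mulVec (eigenvec m (z - rot θ) (z - rot (-θ))) (p, i) =
        (∑ y, (A m θ (p, i) y : ℂ) * eigenvec m (z - rot θ) (z - rot (-θ)) y) -
        lam * ∑ y, (K m (gain m c ε) (p, i) y : ℂ) *
          eigenvec m (z - rot θ) (z - rot (-θ)) y := by
      rw [Finset.mul_sum, ← Finset.sum_sub_distrib]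
      refine Finset.sum_congr rfl fun y _ => ?_
      simp [closedLoop]
      ring
    rw [this, hA, hK]
    simp only [Pi.smul_apply, smul_eq_mul, Pi.zero_apply]
    split_ifs
    · unfold charFun at hz
      have hI := Complex.I_ne_zero
      have e : (lam : ℂ) = lam / (2 * Complex.I) * (2 * Complex.I) := by field_simp
      generalize (lam : ℂ) / (2 * Complex.I) = L at hz e
      rw [e]
      linear_combination 2 * Complex.I * hz
    · ring

/-! ### Persistence of isolated zeros. -/

/-- A holomorphic family that depends continuously on a real parameter has a zero near an isolated
zero of its limit. -/
theorem exists_tendsto_zero {f : ℂ → ℝ → ℂ} (hc : Continuous (Function.uncurry f))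
    (hd : ∀ δ, Differentiable ℂ fun w => f w δ) {w₀ : ℂ} (h0 : f w₀ 0 = 0)
    (hiso : ∀ᶠ w in 𝓝[≠] w₀, f w 0 ≠ 0) :
    ∃ w : ℝ → ℂ, Tendsto w (𝓝[>] 0) (𝓝 w₀) ∧ ∀ᶠ δ in 𝓝[>] (0 : ℝ), f (w δ) δ = 0 := by
  have key : ∀ r > 0, ∀ᶠ δ in 𝓝[>] (0 : ℝ), ∃ w, f w δ = 0 ∧ dist w w₀ < r := by
    intro r hr
    obtain ⟨s, hs, hs'⟩ := Metric.eventually_nhds_iff.mp (eventually_nhdsWithin_iff.mp hiso)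
    obtain ⟨q, hq0, hq⟩ : ∃ q > 0, q < min r s := ⟨min r s / 2, by positivity, by
      have : 0 < min r s := lt_min hr hs
      linarith⟩
    have hqr := hq.trans_le (min_le_left _ _)
    have hqs := hq.trans_le (min_le_right _ _)
    have hcf : Continuous fun w => f w 0 := hc.comp (by fun_prop : Continuous fun w : ℂ => (w, (0 : ℝ)))
    obtain ⟨z₁, hz₁, hmin⟩ := (isCompact_sphere w₀ q).exists_isMinOn
      (NormedSpace.sphere_nonempty.mpr hq0.le) (hcf.norm.continuousOn)
    set μ := ‖f z₁ 0‖ with hμ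
    have hz₁' : dist z₁ w₀ = q := hz₁
    have hμ0 : 0 < μ := by
      refine norm_pos_iff.mpr (hs' (by rw [hz₁']; exact hqs) ?_)
      intro h
      rw [h] at hz₁'
      simp at hz₁'
      exact hq0.ne hz₁'
    have hunif : ∀ᶠ δ in 𝓝 (0 : ℝ), ∀ w ∈ Metric.closedBall w₀ q, ‖f w δ - f w 0‖ < μ / 4 := by
      refine (isCompact_closedBall w₀ q).eventually_forall_of_forall_eventually fun w _ => ?_
      have hcont : Continuous fun x : ℝ × ℂ => ‖f x.2 x.1 - f x.2 0‖ := by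
        have h1 : Continuous fun x : ℝ × ℂ => f x.2 x.1 := hc.comp (by fun_prop : Continuous fun x : ℝ × ℂ => (x.2, x.1))
        have h2 : Continuous fun x : ℝ × ℂ => f x.2 0 := hcf.comp continuous_snd
        exact (h1.sub h2).norm
      refine hcont.continuousAt.eventually_lt continuousAt_const ?_
      simp; positivity
    filter_upwards [hunif.filter_mono nhdsWithin_le_nhds] with δ hδ
    have hw₀ : ‖f w₀ δ‖ < μ / 4 := by
      simpa [h0] using hδ w₀ (Metric.mem_closedBall_self hq0.le)
    have hsph : ∀ z ∈ Metric.sphere w₀ q, μ / 2 ≤ ‖f z δ - f w₀ δ‖ := by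
      intro z hz
      have h1 : μ ≤ ‖f z 0‖ := hmin hz
      have h2 := hδ z (Metric.sphere_subset_closedBall hz)
      have h3 : ‖f z 0‖ ≤ ‖f z δ - f w₀ δ‖ + ‖f w₀ δ‖ + ‖f z δ - f z 0‖ := by
        have : f z 0 = (f z δ - f w₀ δ) + f w₀ δ - (f z δ - f z 0) := by ring
        calc ‖f z 0‖ = ‖(f z δ - f w₀ δ) + f w₀ δ - (f z δ - f z 0)‖ := by rw [← this]
          _ ≤ _ := (norm_sub_le _ _).trans (by gcongr; exact norm_add_le _ _)
      linarith
    -- Local constancy would spread to the whole plane by the identity theorem and contradict the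
    -- lower bound on the circle.
    have hfreq : ∃ᶠ z in 𝓝 w₀, f z δ ≠ f w₀ δ := by
      intro hcon
      have hcon' : (fun z => f z δ) =ᶠ[𝓝 w₀] fun _ => f w₀ δ := hcon.mono fun z hz => not_not.mp hz
      have := AnalyticOnNhd.eq_of_eventuallyEq (fun z _ => (hd δ).analyticAt z)
        (fun z _ => analyticAt_const) hcon'
      have h1 := hsph z₁ hz₁
      have h2 := congrFun this z₁
      rw [h2] at h1
      simp at h1
      linarith
    -- Quantitative open mapping: the image of the disc covers the ball of radius μ/4 around `f w₀
    -- δ`, and that ball contains 0.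
    have hsub := (hd δ).diffContOnCl.ball_subset_image_closedBall hq0 hsph hfreq
    obtain ⟨w, hw, hw'⟩ := hsub (show (0 : ℂ) ∈ Metric.ball (f w₀ δ) (μ / 2 / 2) by
      rw [Metric.mem_ball, dist_comm, dist_zero_right]; linarith)
    exact ⟨w, hw', (Metric.mem_closedBall.mp hw).trans_lt hqr⟩
  -- The zero is chosen almost nearest to `w₀`, with slack δ. A single choice then serves every
  -- radius r.
  have hsel : ∀ δ : ℝ, ∃ w, 0 < δ → (∃ w, f w δ = 0) →
      f w δ = 0 ∧ dist w₀ w < Metric.infDist w₀ {w | f w δ = 0} + δ := by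
    intro δ
    by_cases h : 0 < δ ∧ ∃ w, f w δ = 0
    · obtain ⟨w, hw, hw'⟩ := (Metric.infDist_lt_iff (s := {w | f w δ = 0}) h.2).mp
        (lt_add_of_pos_right (Metric.infDist w₀ {w | f w δ = 0}) h.1)
      exact ⟨w, fun _ _ => ⟨hw, hw'⟩⟩
    · exact ⟨0, fun h1 h2 => absurd ⟨h1, h2⟩ h⟩
  choose w hw using hsel
  refine ⟨w, ?_, ?_⟩
  · rw [Metric.tendsto_nhds]
    intro r hr
    filter_upwards [key (r / 2) (by positivity), self_mem_nhdsWithin,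
      (eventually_lt_nhds (show (0 : ℝ) < r / 2 by positivity)).filter_mono nhdsWithin_le_nhds]
      with δ h1 h2 h3
    obtain ⟨x, hx, hx'⟩ := h1
    have h4 := (hw δ h2 ⟨x, hx⟩).2
    have h5 : Metric.infDist w₀ {w | f w δ = 0} ≤ dist w₀ x := Metric.infDist_le_dist_of_mem hx
    rw [dist_comm] at hx' ⊢
    linarith
  · filter_upwards [key 1 one_pos, self_mem_nhdsWithin] with δ h1 h2
    obtain ⟨x, hx, -⟩ := h1
    exact (hw δ h2 ⟨x, hx⟩).1

/-! ### Zeros near e^{iθ} on the scales ε and √ε. -/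

lemma sum_scale (k : ℕ) (γ : ℕ → ℂ) (ε : ℝ) (u : ℂ) :
    ∑ p ∈ Finset.range (k + 2), γ p * scale (k + 2) ε p * u ^ p =
      ∑ p ∈ Finset.range (k + 1), γ p * (ε : ℂ) ^ (k + 1 - p) * u ^ p +
        γ (k + 1) * ε * u ^ (k + 1) := by
  rw [Finset.sum_range_succ]
  congr 1
  · refine Finset.sum_congr rfl fun p hp => ?_
    have := Finset.mem_range.mp hp
    rw [scale, if_pos (by omega), show k + 2 - (p + 1) = k + 1 - p by omega]
    push_cast; rfl
  · simp [scale]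

/-- Zeros of `charFun` at distance of order `ε` from `e^{iθ}`. -/
theorem exists_root_order_one (k : ℕ) {θ lam : ℝ} (hθ : Real.sin θ ≠ 0) (hlam : lam ≠ 0)
    {c : ℕ → ℝ} (hk : blockGain c k ≠ 0) {ϑ : ℂ}
    (hϑ : ∑ p ∈ Finset.range (k + 1), blockGain c p * ϑ ^ p = 0) :
    ∃ w : ℝ → ℂ, Tendsto w (𝓝[>] 0) (𝓝 ϑ) ∧
      ∀ᶠ ε in 𝓝[>] (0 : ℝ), charFun (k + 2) θ lam c ε (rot θ + ε * w ε) = 0 := by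
  set L : ℂ := lam / (2 * Complex.I) with hL
  have hL0 : L ≠ 0 := div_ne_zero (by exact_mod_cast hlam) (by simp)
  set d : ℂ := rot θ - rot (-θ) with hd
  have hd0 : d ≠ 0 := rot_sub_rot_neg_ne_zero hθ
  -- This is `charFun` at u = εw divided by ε^{k+1}. The remaining positive powers of ε vanish in
  -- the limit and leave the auxiliary polynomial.
  let Φ : ℂ → ℝ → ℂ := fun w ε =>
    ε * w ^ (k + 2) * (d + ε * w) ^ (k + 2) +
      L * ((d + ε * w) ^ (k + 2) * (∑ p ∈ Finset.range (k + 1), blockGain c p * w ^ p +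
        blockGain c (k + 1) * ε * w ^ (k + 1)) -
        ε * w ^ (k + 2) * (∑ p ∈ Finset.range (k + 1),
          (starRingEnd ℂ) (blockGain c p) * (ε : ℂ) ^ (k + 1 - p) * (d + ε * w) ^ p +
          (starRingEnd ℂ) (blockGain c (k + 1)) * ε * (d + ε * w) ^ (k + 1)))
  have hΦ0 : ∀ w, Φ w 0 =
      L * (d ^ (k + 2) * ∑ p ∈ Finset.range (k + 1), blockGain c p * w ^ p) := by
    intro w; simp [Φ]
  have hΦ : ∀ (w : ℂ) (ε : ℝ),
      charFun (k + 2) θ lam c ε (rot θ + ε * w) = (ε : ℂ) ^ (k + 1) * Φ w ε := by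
    intro w ε
    have e1 : rot θ + ε * w - rot θ = ε * w := by ring
    have e2 : rot θ + ε * w - rot (-θ) = d + ε * w := by rw [hd]; ring
    have e3 : ∑ p ∈ Finset.range (k + 1),
        blockGain c p * (ε : ℂ) ^ (k + 1 - p) * (ε * w) ^ p =
        (ε : ℂ) ^ (k + 1) * ∑ p ∈ Finset.range (k + 1), blockGain c p * w ^ p := by
      rw [Finset.mul_sum]
      refine Finset.sum_congr rfl fun p hp => ?_
      have hp' := Finset.mem_range.mp hp
      rw [mul_pow, show (ε : ℂ) ^ (k + 1) = (ε : ℂ) ^ (k + 1 - p) * (ε : ℂ) ^ p by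
        rw [← pow_add]; congr 1; omega]
      ring
    simp only [charFun, sum_scale k (blockGain c),
      sum_scale k (fun p => (starRingEnd ℂ) (blockGain c p)), e1, e2, e3, ← hL, Φ]
    ring
  obtain ⟨w, hw, hw'⟩ := exists_tendsto_zero (f := Φ) (w₀ := ϑ)
    (by simp only [Φ, Function.uncurry_def]; fun_prop) (fun ε => by simp only [Φ]; fun_prop)
    (by rw [hΦ0, hϑ]; simp) (by
      let P : Polynomial ℂ := ∑ p ∈ Finset.range (k + 1), Polynomial.monomial p (blockGain c p)
      have hP : P ≠ 0 := by
        intro h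
        have h1 : P.coeff k = blockGain c k := by
          simp [P, Polynomial.coeff_monomial]
        rw [h] at h1
        exact hk (by simpa using h1.symm)
      have hPe : ∀ w, P.eval w = ∑ p ∈ Finset.range (k + 1), blockGain c p * w ^ p := by
        intro w; simp [P, Polynomial.eval_finsetSum]
      have hfin : {w | P.eval w = 0}.Finite :=
        P.roots.toFinset.finite_toSet.subset fun w hw => by
          simpa [hP, Polynomial.IsRoot] using hw
      filter_upwards [nhdsNE_le_cofinite ϑ hfin.compl_mem_cofinite] with w hw
      rw [hΦ0, ← hPe]
      exact mul_ne_zero hL0 (mul_ne_zero (pow_ne_zero _ hd0) hw))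
  exact ⟨w, hw, hw'.mono fun ε h => by rw [hΦ, h, mul_zero]⟩

/-- Zeros of `charFun` at distance of order `√ε` from `e^{iθ}`. -/
theorem exists_root_order_half (k : ℕ) {θ lam : ℝ} (hθ : Real.sin θ ≠ 0)
    {c : ℕ → ℝ} (hk : blockGain c k = Complex.I * rot θ ^ 2) {s t : ℂ} (hs0 : s ≠ 0)
    (hs : s ^ 2 = -(lam / 2))
    (ht : 2 * rot θ ^ (k + 2) * s ^ (k + 1) * t + lam / (2 * Complex.I) *
      (∑ p ∈ Finset.range k, blockGain c p * rot θ ^ p * 0 ^ (k - 1 - p) * s ^ p +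
        blockGain c (k + 1) * rot θ ^ (k + 1) * s ^ (k + 1)) = 0) :
    ∃ w : ℝ → ℂ, Tendsto w (𝓝[>] 0) (𝓝 t) ∧ ∀ᶠ δ in 𝓝[>] (0 : ℝ),
      charFun (k + 2) θ lam c (δ ^ 2) (rot θ * (1 + δ * s + δ ^ 2 * w δ)) = 0 := by
  set L : ℂ := lam / (2 * Complex.I) with hL
  set d : ℂ := rot θ - rot (-θ) with hd
  have hd0 : d ≠ 0 := rot_sub_rot_neg_ne_zero hθ
  have ha0 := rot_ne_zero θ
  set a : ℂ := rot θ with ha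
  -- This is `charFun` at u = aδ(s + δw) divided by δ^{k+3}. The order δ^{k+2} cancels because L γ_k
  -- = -a² s², up to (s + δw)² - s², which supplies one more δ. At δ = 0 the first sum keeps only p
  -- = k - 1, and the quotient is affine in w with zero t.
  let Ψ : ℂ → ℝ → ℂ := fun w δ =>
    (d + a * δ * (s + δ * w)) ^ (k + 2) *
      (a ^ (k + 2) * (s + δ * w) ^ k * (2 * s * w + δ * w ^ 2) +
        L * (∑ p ∈ Finset.range k, blockGain c p * a ^ p * (δ : ℂ) ^ (k - 1 - p) * (s + δ * w) ^ p +
          blockGain c (k + 1) * a ^ (k + 1) * (s + δ * w) ^ (k + 1))) -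
      L * (a ^ (k + 2) * (s + δ * w) ^ (k + 2) * (∑ p ∈ Finset.range (k + 1),
        (starRingEnd ℂ) (blockGain c p) * (δ : ℂ) ^ (2 * k + 1 - 2 * p) *
          (d + a * δ * (s + δ * w)) ^ p +
        (starRingEnd ℂ) (blockGain c (k + 1)) * δ * (d + a * δ * (s + δ * w)) ^ (k + 1)))
  have hΨ0 : ∀ w, Ψ w 0 = d ^ (k + 2) * (2 * a ^ (k + 2) * s ^ (k + 1) * (w - t)) := by
    intro w
    have hz : ∑ p ∈ Finset.range (k + 1), (starRingEnd ℂ) (blockGain c p) *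
        (0 : ℂ) ^ (2 * k + 1 - 2 * p) * d ^ p = 0 :=
      Finset.sum_eq_zero fun p hp => by
        have := Finset.mem_range.mp hp
        rw [zero_pow (by omega)]; ring
    simp only [Ψ, Complex.ofReal_zero, mul_zero, zero_mul, add_zero, hz]
    linear_combination d ^ (k + 2) * ht
  have hΨ : ∀ (w : ℂ) (δ : ℝ),
      charFun (k + 2) θ lam c (δ ^ 2) (a * (1 + δ * s + δ ^ 2 * w)) =
        (δ : ℂ) ^ (k + 3) * Ψ w δ := by
    intro w δ
    have e1 : a * (1 + δ * s + δ ^ 2 * w) - rot θ = a * δ * (s + δ * w) := by rw [← ha]; ring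
    have e2 : a * (1 + δ * s + δ ^ 2 * w) - rot (-θ) = d + a * δ * (s + δ * w) := by rw [hd]; ring
    have e3 : ∑ p ∈ Finset.range (k + 1),
        blockGain c p * ((δ ^ 2 : ℝ) : ℂ) ^ (k + 1 - p) * (a * δ * (s + δ * w)) ^ p =
        (δ : ℂ) ^ (k + 3) * ∑ p ∈ Finset.range k,
          blockGain c p * a ^ p * (δ : ℂ) ^ (k - 1 - p) * (s + δ * w) ^ p +
        (δ : ℂ) ^ (k + 2) * (Complex.I * a ^ 2) * a ^ k * (s + δ * w) ^ k := by
      rw [Finset.sum_range_succ, hk, Finset.mul_sum]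
      congr 1
      · refine Finset.sum_congr rfl fun p hp => ?_
        have hp' := Finset.mem_range.mp hp
        have : ((δ ^ 2 : ℝ) : ℂ) ^ (k + 1 - p) * (δ : ℂ) ^ p =
            (δ : ℂ) ^ (k + 3) * (δ : ℂ) ^ (k - 1 - p) := by
          push_cast
          rw [← pow_mul, ← pow_add, ← pow_add]; congr 1; omega
        rw [mul_pow, mul_pow]
        linear_combination blockGain c p * a ^ p * (s + δ * w) ^ p * this
      · simp only [Nat.add_sub_cancel_left, pow_one, mul_pow]
        push_cast; ring
    have e4 : ∑ p ∈ Finset.range (k + 1), (starRingEnd ℂ) (blockGain c p) *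
          ((δ ^ 2 : ℝ) : ℂ) ^ (k + 1 - p) * (d + a * δ * (s + δ * w)) ^ p =
        δ * ∑ p ∈ Finset.range (k + 1), (starRingEnd ℂ) (blockGain c p) *
          (δ : ℂ) ^ (2 * k + 1 - 2 * p) * (d + a * δ * (s + δ * w)) ^ p := by
      rw [Finset.mul_sum]
      refine Finset.sum_congr rfl fun p hp => ?_
      have hp' := Finset.mem_range.mp hp
      have : ((δ ^ 2 : ℝ) : ℂ) ^ (k + 1 - p) = δ * (δ : ℂ) ^ (2 * k + 1 - 2 * p) := by
        push_cast
        rw [← pow_mul, ← pow_succ']; congr 1; omega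
      rw [this]; ring
    have e5 : L * Complex.I = -s ^ 2 := by
      rw [hs, hL]; field_simp
    simp only [charFun, sum_scale k (blockGain c),
      sum_scale k (fun p => (starRingEnd ℂ) (blockGain c p)), e1, e2, e3, e4, ← hL, Ψ]
    push_cast
    generalize d + a * δ * (s + δ * w) = v
    generalize ∑ p ∈ Finset.range (k + 1), (starRingEnd ℂ) (blockGain c p) *
      (δ : ℂ) ^ (2 * k + 1 - 2 * p) * v ^ p = S1
    generalize ∑ p ∈ Finset.range k,
      blockGain c p * a ^ p * (δ : ℂ) ^ (k - 1 - p) * (s + δ * w) ^ p = S2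
    have e6 : δ * (2 * s * w + δ * w ^ 2) = (s + δ * w) ^ 2 - s ^ 2 := by ring
    generalize s + δ * w = q at e6 ⊢
    clear_value L
    simp only [mul_pow]
    linear_combination v ^ (k + 2) * (δ : ℂ) ^ (k + 2) * a ^ (k + 2) * q ^ k * (e5 - e6)
  obtain ⟨w, hw, hw'⟩ := exists_tendsto_zero (f := Ψ) (w₀ := t)
    (by simp only [Ψ, Function.uncurry_def]; fun_prop) (fun ε => by simp only [Ψ]; fun_prop)
    (by rw [hΨ0]; simp) (by
      filter_upwards [self_mem_nhdsWithin] with w hw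
      rw [hΨ0]
      exact mul_ne_zero (pow_ne_zero _ hd0) (mul_ne_zero (mul_ne_zero (mul_ne_zero two_ne_zero
        (pow_ne_zero _ ha0)) (pow_ne_zero _ hs0)) (sub_ne_zero.mpr hw)))
  exact ⟨w, hw, hw'.mono fun ε h => by rw [hΨ, h, mul_zero]⟩

/-! ### From eigenvalue expansions to the spectral radius. -/

/-- As many distinct eigenvalues as the size of the matrix make up the whole spectrum. -/
lemma spectrum_eq_range {n ι : Type*} [Fintype n] [DecidableEq n] [Fintype ι]
    (hcard : Fintype.card ι = Fintype.card n) {M : Matrix n n ℂ} {z : ι → ℂ}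
    (hz : ∀ i, z i ∈ spectrum ℂ M) (hinj : Function.Injective z) :
    spectrum ℂ M = Set.range z := by
  classical
  have hsub : Set.range z ⊆ spectrum ℂ M := Set.range_subset_iff.mpr hz
  have hroots : spectrum ℂ M ⊆ (M.charpoly.roots.toFinset : Set ℂ) := fun x hx => by
    simpa [M.charpoly_monic.ne_zero] using Matrix.mem_spectrum_iff_isRoot_charpoly.mp hx
  refine (Set.eq_of_subset_of_ncard_le hsub ?_ (Matrix.finite_spectrum M)).symm
  calc (spectrum ℂ M).ncard ≤ (M.charpoly.roots.toFinset : Set ℂ).ncard :=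
        Set.ncard_le_ncard hroots (Finset.finite_toSet _)
    _ = M.charpoly.roots.toFinset.card := Set.ncard_coe_finset _
    _ ≤ M.charpoly.natDegree :=
        (Multiset.toFinset_card_le _).trans (Polynomial.card_roots' _)
    _ = Fintype.card ι := by rw [Matrix.charpoly_natDegree_eq_dim, hcard]
    _ = (Set.range z).ncard := by
        rw [← Set.image_univ, Set.ncard_image_of_injective _ hinj, Set.ncard_univ,
          Nat.card_eq_fintype_card]

lemma spectralRadius_eq_of_range {n ι : Type*} [Fintype n] [DecidableEq n]
    {M : Matrix n n ℂ} {z : ι → ℂ} (h : spectrum ℂ M = Set.range z) {i₀ : ι}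
    (hi₀ : ∀ i, ‖z i‖ ≤ ‖z i₀‖) : spectralRadius ℂ M = ENNReal.ofReal ‖z i₀‖ := by
  rw [spectralRadius, h, iSup_range]
  refine le_antisymm (iSup_le fun i => ?_) ?_
  · change ‖z i‖ₑ ≤ _
    rw [← ofReal_norm]
    exact ENNReal.ofReal_le_ofReal (hi₀ i)
  · rw [ofReal_norm]
    exact le_iSup (fun i => ‖z i‖ₑ) i₀

/-- First-order asymptotics of the spectral radius from those of all the eigenvalues. -/
theorem spectralRadius_asymptotics {n ι : Type*} [Fintype n] [DecidableEq n] [Fintype ι]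
    (hcard : Fintype.card ι = Fintype.card n) {M : ℝ → Matrix n n ℂ} {z : ι → ℝ → ℂ} {κ : ι → ℝ}
    {μ : ℝ} (hz : ∀ i, ∀ᶠ ε in 𝓝[>] (0 : ℝ), z i ε ∈ spectrum ℂ (M ε))
    (hne : ∀ i j, i ≠ j → ∀ᶠ ε in 𝓝[>] (0 : ℝ), z i ε ≠ z j ε)
    (hκ : ∀ i, (fun ε : ℝ => ‖z i ε‖ - (1 + κ i * ε)) =o[𝓝[>] 0] fun ε : ℝ => ε)
    (hμ : IsGreatest (Set.range κ) μ) :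
    (μ < 0 → ∀ᶠ ε in 𝓝[>] (0 : ℝ), spectralRadius ℂ (M ε) < 1) ∧
      (∀ᶠ ε in 𝓝[>] (0 : ℝ), (spectrum ℂ (M ε)).ncard = Fintype.card n) ∧
      (fun ε : ℝ => (spectralRadius ℂ (M ε)).toReal - (1 + μ * ε)) =o[𝓝[>] 0] fun ε : ℝ => ε := by
  obtain ⟨⟨i₁, hi₁⟩, hub⟩ := hμ
  have hub' : ∀ i, κ i ≤ μ := fun i => hub ⟨i, rfl⟩
  have hinj : ∀ᶠ ε in 𝓝[>] (0 : ℝ), Function.Injective fun i => z i ε := by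
    have : ∀ᶠ ε in 𝓝[>] (0 : ℝ), ∀ i j, i ≠ j → z i ε ≠ z j ε := by
      simp only [eventually_all]
      exact hne
    filter_upwards [this] with ε h i j hij
    by_contra hcon
    exact h i j hcon hij
  have hspec : ∀ᶠ ε in 𝓝[>] (0 : ℝ), spectrum ℂ (M ε) = Set.range fun i => z i ε := by
    filter_upwards [eventually_all.mpr hz, hinj] with ε h1 h2
    exact spectrum_eq_range hcard h1 h2
  -- The maximizing index may change with ε. Upper bounds use κ ≤ μ at that index, the lower bound
  -- uses the fixed `i₁` where κ equals μ.
  have hrad : ∀ᶠ ε in 𝓝[>] (0 : ℝ), ∃ i₀, (∀ i, ‖z i ε‖ ≤ ‖z i₀ ε‖) ∧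
      spectralRadius ℂ (M ε) = ENNReal.ofReal ‖z i₀ ε‖ := by
    filter_upwards [hspec] with ε h
    have : Nonempty ι := ⟨i₁⟩
    obtain ⟨i₀, h₀⟩ := Finite.exists_max fun i => ‖z i ε‖
    exact ⟨i₀, h₀, spectralRadius_eq_of_range h h₀⟩
  refine ⟨fun hneg => ?_, ?_, ?_⟩
  · have : ∀ᶠ ε in 𝓝[>] (0 : ℝ), ∀ i, ‖‖z i ε‖ - (1 + κ i * ε)‖ ≤ (-μ / 2) * ‖ε‖ :=
      eventually_all.mpr fun i => isLittleO_iff.mp (hκ i) (by linarith)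
    filter_upwards [this, hrad, self_mem_nhdsWithin] with ε h1 h2' h3
    obtain ⟨i₀, -, h2⟩ := h2'
    rw [h2, ENNReal.ofReal_lt_one]
    have h3' : (0 : ℝ) < ε := h3
    have h4 := (abs_le.mp (h1 i₀)).2
    rw [Real.norm_of_nonneg h3'.le] at h4
    have h5 := mul_le_mul_of_nonneg_right (hub' i₀) h3'.le
    have h6 := mul_neg_of_neg_of_pos hneg h3'
    linarith
  · filter_upwards [hspec, hinj] with ε h1 h2
    rw [h1, ← Set.image_univ, Set.ncard_image_of_injective _ h2, Set.ncard_univ,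
      Nat.card_eq_fintype_card, hcard]
  · rw [isLittleO_iff]
    intro b hb
    have : ∀ᶠ ε in 𝓝[>] (0 : ℝ), ∀ i, ‖‖z i ε‖ - (1 + κ i * ε)‖ ≤ b * ‖ε‖ :=
      eventually_all.mpr fun i => isLittleO_iff.mp (hκ i) hb
    filter_upwards [this, hrad, self_mem_nhdsWithin] with ε h1 h2' h3
    obtain ⟨i₀, hmax, h2⟩ := h2'
    have h3' : (0 : ℝ) < ε := h3
    rw [h2, ENNReal.toReal_ofReal (norm_nonneg _)]
    refine abs_le.mpr ⟨?_, ?_⟩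
    · have h4 := (abs_le.mp (h1 i₁)).1
      rw [hi₁] at h4
      linarith [hmax i₁]
    · have h4 := (abs_le.mp (h1 i₀)).2
      have h5 := mul_le_mul_of_nonneg_right (hub' i₀) h3'.le
      linarith

/-- The first-order term is tangent to the unit circle, so it enters the squared modulus only as
σ²δ², beside 2 Re(T) δ². Dividing r² - 1 by r + 1 → 2 gives the modulus. -/
lemma norm_rot_mul_asymptotics (θ σ : ℝ) {w : ℝ → ℂ} {T : ℂ} (hw : Tendsto w (𝓝[>] 0) (𝓝 T)) :
    (fun δ : ℝ => ‖rot θ * (1 + δ * (Complex.I * σ) + δ ^ 2 * w δ)‖ -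
      (1 + (T.re + σ ^ 2 / 2) * δ ^ 2)) =o[𝓝[>] 0] fun δ : ℝ => δ ^ 2 := by
  have hδ : Tendsto (fun δ : ℝ => δ) (𝓝[>] 0) (𝓝 0) := tendsto_id.mono_left nhdsWithin_le_nhds
  have hδc : Tendsto (fun δ : ℝ => (δ : ℂ)) (𝓝[>] 0) (𝓝 0) := by
    simpa using (Complex.continuous_ofReal.tendsto 0).mono_left nhdsWithin_le_nhds
  have hre := (Complex.continuous_re.tendsto T).comp hw
  have him := (Complex.continuous_im.tendsto T).comp hw
  set r : ℝ → ℝ := fun δ => ‖rot θ * (1 + δ * (Complex.I * σ) + δ ^ 2 * w δ)‖ with hr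
  have hr1 : Tendsto r (𝓝[>] 0) (𝓝 1) := by
    have := (((tendsto_const_nhds (x := (1 : ℂ))).add (hδc.mul_const (Complex.I * σ))).add
      ((hδc.pow 2).mul hw)).norm
    simp only [hr, norm_mul, norm_rot, one_mul]
    simpa using this
  have hsq : ∀ δ, r δ ^ 2 - 1 = δ ^ 2 * (2 * (w δ).re + σ ^ 2 + δ ^ 2 * (w δ).re ^ 2 +
      2 * δ * σ * (w δ).im + δ ^ 2 * (w δ).im ^ 2) := by
    intro δ
    simp only [hr, norm_mul, norm_rot, one_mul]
    rw [← Complex.normSq_eq_norm_sq, Complex.normSq_apply]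
    simp [← Complex.ofReal_pow]
    ring
  have hlim : Tendsto (fun δ => (2 * (w δ).re + σ ^ 2 + δ ^ 2 * (w δ).re ^ 2 +
      2 * δ * σ * (w δ).im + δ ^ 2 * (w δ).im ^ 2) / (r δ + 1) - (T.re + σ ^ 2 / 2))
      (𝓝[>] 0) (𝓝 0) := by
    have := (((((((hre.const_mul 2).add_const (σ ^ 2)).add ((hδ.pow 2).mul (hre.pow 2))).add
      (((hδ.const_mul 2).mul_const σ).mul him)).add ((hδ.pow 2).mul (him.pow 2))).div
      (hr1.add_const 1) (by norm_num)).sub_const (T.re + σ ^ 2 / 2))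
    rw [show (2 * T.re + σ ^ 2 + 0 ^ 2 * T.re ^ 2 + 2 * 0 * σ * T.im + 0 ^ 2 * T.im ^ 2) / (1 + 1) -
      (T.re + σ ^ 2 / 2) = 0 by ring] at this
    exact this
  rw [isLittleO_iff_tendsto' (by
    filter_upwards [self_mem_nhdsWithin] with δ h h'
    exact absurd h' (pow_ne_zero 2 (ne_of_gt h)))]
  refine hlim.congr' ?_
  filter_upwards [self_mem_nhdsWithin] with δ h
  have h0 : δ ≠ 0 := ne_of_gt h
  have h1 : r δ + 1 ≠ 0 := by
    have : 0 ≤ r δ := norm_nonneg _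
    positivity
  have := hsq δ
  change _ = (r δ - _) / _
  clear_value r
  field_simp
  linear_combination -2 * this

/-- Different σ separate the points at order δ; equal σ with different T separate them at order δ².
-/
lemma eventually_ne_of_limits_ne (θ : ℝ) {σ₁ σ₂ : ℝ} {w₁ w₂ : ℝ → ℂ} {T₁ T₂ : ℂ}
    (h₁ : Tendsto w₁ (𝓝[>] 0) (𝓝 T₁)) (h₂ : Tendsto w₂ (𝓝[>] 0) (𝓝 T₂))
    (hne : (σ₁, T₁) ≠ (σ₂, T₂)) :
    ∀ᶠ δ in 𝓝[>] (0 : ℝ), rot θ * (1 + δ * (Complex.I * σ₁) + δ ^ 2 * w₁ δ) ≠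
      rot θ * (1 + δ * (Complex.I * σ₂) + δ ^ 2 * w₂ δ) := by
  by_cases hσ : σ₁ = σ₂
  · have hT : T₁ - T₂ ≠ 0 := sub_ne_zero.mpr fun h => hne (by rw [hσ, h])
    filter_upwards [(h₁.sub h₂).eventually_ne hT, self_mem_nhdsWithin] with δ h hδ heq
    have h0 : (δ : ℂ) ≠ 0 := by exact_mod_cast ne_of_gt hδ
    have := mul_left_cancel₀ (rot_ne_zero θ) heq
    rw [hσ] at this
    refine h (mul_left_cancel₀ (pow_ne_zero 2 h0) ?_)
    linear_combination this
  · have hδc : Tendsto (fun δ : ℝ => (δ : ℂ)) (𝓝[>] 0) (𝓝 0) := by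
      simpa using (Complex.continuous_ofReal.tendsto 0).mono_left nhdsWithin_le_nhds
    have hlim : Tendsto (fun δ : ℝ => Complex.I * σ₁ - Complex.I * σ₂ + δ * (w₁ δ - w₂ δ))
        (𝓝[>] 0) (𝓝 (Complex.I * σ₁ - Complex.I * σ₂ + 0 * (T₁ - T₂))) :=
      tendsto_const_nhds.add (hδc.mul (h₁.sub h₂))
    have hne' : Complex.I * σ₁ - Complex.I * σ₂ + 0 * (T₁ - T₂) ≠ 0 := by
      rw [zero_mul, add_zero, ← mul_sub]
      exact mul_ne_zero Complex.I_ne_zero (sub_ne_zero.mpr (by exact_mod_cast hσ))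
    filter_upwards [hlim.eventually_ne hne', self_mem_nhdsWithin] with δ h hδ heq
    have h0 : (δ : ℂ) ≠ 0 := by exact_mod_cast ne_of_gt hδ
    have := mul_left_cancel₀ (rot_ne_zero θ) heq
    refine h (mul_left_cancel₀ h0 ?_)
    linear_combination this

lemma tendsto_rot_mul (θ σ : ℝ) {w : ℝ → ℂ} {T : ℂ} (hw : Tendsto w (𝓝[>] 0) (𝓝 T)) :
    Tendsto (fun δ : ℝ => rot θ * (1 + δ * (Complex.I * σ) + δ ^ 2 * w δ)) (𝓝[>] 0)
      (𝓝 (rot θ)) := by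
  have hδc : Tendsto (fun δ : ℝ => (δ : ℂ)) (𝓝[>] 0) (𝓝 0) := by
    simpa using (Complex.continuous_ofReal.tendsto 0).mono_left nhdsWithin_le_nhds
  simpa using (((tendsto_const_nhds (x := (1 : ℂ))).add (hδc.mul_const (Complex.I * σ))).add
    ((hδc.pow 2).mul hw)).const_mul (rot θ)

lemma tendsto_sqrt_nhdsGT_zero : Tendsto Real.sqrt (𝓝[>] 0) (𝓝[>] 0) :=
  tendsto_nhdsWithin_iff.mpr
    ⟨by simpa using (Real.continuous_sqrt.tendsto 0).mono_left nhdsWithin_le_nhds,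
      by filter_upwards [self_mem_nhdsWithin] with ε h using Real.sqrt_pos.mpr h⟩

/-! ### Assembling the spectrum. -/

/-- The asymptotics of the closed loop from half of the zeros of `charFun`, those near `e^{iθ}`. -/
theorem closedLoop_asymptotics {m : ℕ} (hm : 0 < m) {θ lam : ℝ} (hθ : Real.sin θ ≠ 0)
    {c : ℕ → ℝ} {ι : Type*} [Fintype ι] (hcard : Fintype.card ι = m) {σ : ι → ℝ} {T : ι → ℂ}
    (hinj : Function.Injective fun i => (σ i, T i)) {w : ι → ℝ → ℂ}
    (hw : ∀ i, Tendsto (w i) (𝓝[>] 0) (𝓝 (T i)))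
    (hroot : ∀ i, ∀ᶠ δ in 𝓝[>] (0 : ℝ), charFun m θ lam c (δ ^ 2)
      (rot θ * (1 + δ * (Complex.I * σ i) + δ ^ 2 * w i δ)) = 0) {μ : ℝ}
    (hμ : IsGreatest (Set.range fun i => (T i).re + σ i ^ 2 / 2) μ) :
    (μ < 0 → ∀ᶠ ε in 𝓝[>] (0 : ℝ), StableDistinct m θ lam c ε) ∧
      (fun ε : ℝ => (rho m θ lam c ε).toReal - (1 + μ * ε)) =o[𝓝[>] 0] fun ε : ℝ => ε := by
  set Z : ι → ℝ → ℂ := fun i δ => rot θ * (1 + δ * (Complex.I * σ i) + δ ^ 2 * w i δ) with hZ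
  let z : ι × Bool → ℝ → ℂ := fun i ε =>
    if i.2 then Z i.1 (Real.sqrt ε) else (starRingEnd ℂ) (Z i.1 (Real.sqrt ε))
  have hcard' : Fintype.card (ι × Bool) = Fintype.card (Fin m × Fin 2) := by
    simp [hcard]
  have hconj : ∀ i j, ∀ᶠ δ in 𝓝[>] (0 : ℝ), Z i δ ≠ (starRingEnd ℂ) (Z j δ) := by
    intro i j
    have h1 := tendsto_rot_mul θ (σ i) (hw i)
    have h2 := (Complex.continuous_conj.tendsto _).comp (tendsto_rot_mul θ (σ j) (hw j))
    rw [conj_rot] at h2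
    filter_upwards [(h1.sub h2).eventually_ne (rot_sub_rot_neg_ne_zero hθ)] with δ h
    exact sub_ne_zero.mp h
  have hsame : ∀ i j, i ≠ j → ∀ᶠ δ in 𝓝[>] (0 : ℝ), Z i δ ≠ Z j δ := fun i j hij =>
    eventually_ne_of_limits_ne θ (hw i) (hw j) (hinj.ne hij)
  have hmain := spectralRadius_asymptotics hcard' (M := closedLoop m θ lam c) (z := z)
    (κ := fun i => (T i.1).re + σ i.1 ^ 2 / 2) (μ := μ) ?_ ?_ ?_ ?_
  · obtain ⟨h1, h2, h3⟩ := hmain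
    refine ⟨fun hneg => ?_, h3⟩
    filter_upwards [h1 hneg, h2] with ε h4 h5
    exact ⟨h4, by rw [h5]; simp [mul_comm]⟩
  · rintro ⟨i, b⟩
    filter_upwards [tendsto_sqrt_nhdsGT_zero.eventually (hroot i), self_mem_nhdsWithin] with ε h hε
    rw [Real.sq_sqrt (le_of_lt hε)] at h
    refine mem_spectrum_of_charFun_eq_zero hm hθ ?_
    cases b
    · simp only [z, Bool.false_eq_true, if_false, conj_charFun]
      rw [h, map_zero]
    · simpa only [z, if_true] using h
  · rintro ⟨i, b⟩ ⟨j, b'⟩ hij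
    cases b <;> cases b'
    · have hij' : i ≠ j := fun h => hij (by rw [h])
      filter_upwards [tendsto_sqrt_nhdsGT_zero.eventually (hsame i j hij')] with ε h
      simpa [z, -map_mul, -map_add] using fun h' => h ((starRingEnd ℂ).injective h')
    · filter_upwards [tendsto_sqrt_nhdsGT_zero.eventually (hconj j i)] with ε h
      simpa [z] using h.symm
    · filter_upwards [tendsto_sqrt_nhdsGT_zero.eventually (hconj i j)] with ε h
      simpa [z] using h
    · have hij' : i ≠ j := fun h => hij (by rw [h])
      filter_upwards [tendsto_sqrt_nhdsGT_zero.eventually (hsame i j hij')] with ε h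
      simpa [z] using h
  · rintro ⟨i, b⟩
    have h := (norm_rot_mul_asymptotics θ (σ i) (hw i)).comp_tendsto tendsto_sqrt_nhdsGT_zero
    refine h.congr' ?_ ?_
    · filter_upwards [self_mem_nhdsWithin] with ε hε
      have : ‖z (i, b) ε‖ = ‖Z i (Real.sqrt ε)‖ := by
        cases b
        · simp only [z, Bool.false_eq_true, if_false, Complex.norm_conj]
        · simp only [z, if_true]
      rw [this]
      simp only [Function.comp_apply, Real.sq_sqrt (le_of_lt hε), hZ]
    · filter_upwards [self_mem_nhdsWithin] with ε hε
      exact Real.sq_sqrt (le_of_lt hε)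
  · obtain ⟨⟨i, hi⟩, hub⟩ := hμ
    exact ⟨⟨(i, true), hi⟩, by rintro _ ⟨⟨j, b⟩, rfl⟩; exact hub ⟨j, rfl⟩⟩

/-- The asymptotics of the closed loop in terms of the simple zeros of `∑ γ_p z ^ p`. -/
theorem closedLoop_asymptotics_of_roots (k : ℕ) {θ lam : ℝ} (hθ : Real.sin θ ≠ 0)
    (hlam : 0 < lam) {c : ℕ → ℝ} (hk : blockGain c k = Complex.I * rot θ ^ 2) {ϑ : Fin k → ℂ}
    (hinj : Function.Injective ϑ)
    (hϑ : ∀ n, ∑ p ∈ Finset.range (k + 1), blockGain c p * ϑ n ^ p = 0) {t : ℂ}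
    (ht : 2 * rot θ ^ 3 * t = Complex.I * (lam / 2) * blockGain c (k + 1) * rot θ ^ 2 -
      if k = 0 then 0 else Complex.I * blockGain c (k - 1)) {μ : ℝ}
    (hμ : IsGreatest (Set.range (Sum.elim (fun n => (ϑ n * rot (-θ)).re)
      fun _ : Bool => t.re + lam / 4)) μ) :
    (μ < 0 → ∀ᶠ ε in 𝓝[>] (0 : ℝ), StableDistinct (k + 2) θ lam c ε) ∧
      (fun ε : ℝ => (rho (k + 2) θ lam c ε).toReal - (1 + μ * ε)) =o[𝓝[>] 0]
        fun ε : ℝ => ε := by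
  have ha0 := rot_ne_zero θ
  have hab := rot_mul_rot_neg θ
  set s : ℝ := Real.sqrt (lam / 2) with hs
  have hs2 : s ^ 2 = lam / 2 := Real.sq_sqrt (by positivity)
  have hs0 : 0 < s := Real.sqrt_pos.mpr (by positivity)
  -- Zeros of order ε have no √ε term; the two of order √ε leave in opposite tangential directions
  -- with the same second-order limit t. For these σ²/2 = λ/4.
  let σ : Fin k ⊕ Bool → ℝ := Sum.elim (fun _ => 0) fun b => if b then s else -s
  let T : Fin k ⊕ Bool → ℂ := Sum.elim (fun n => ϑ n * rot (-θ)) fun _ => t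
  have hex : ∀ i, ∃ w : ℝ → ℂ, Tendsto w (𝓝[>] 0) (𝓝 (T i)) ∧
      ∀ᶠ δ in 𝓝[>] (0 : ℝ), charFun (k + 2) θ lam c (δ ^ 2)
        (rot θ * (1 + δ * (Complex.I * σ i) + δ ^ 2 * w δ)) = 0 := by
    rintro (n | b)
    · obtain ⟨w, hw, hw'⟩ := exists_root_order_one k hθ hlam.ne'
        (by rw [hk]; exact mul_ne_zero Complex.I_ne_zero (pow_ne_zero _ ha0)) (hϑ n)
      have hsq : Tendsto (fun δ : ℝ => δ ^ 2) (𝓝[>] 0) (𝓝[>] 0) :=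
        tendsto_nhdsWithin_iff.mpr
          ⟨by simpa using ((continuous_pow 2).tendsto (0 : ℝ)).mono_left nhdsWithin_le_nhds,
            eventually_of_mem self_mem_nhdsWithin fun δ h => pow_pos (Set.mem_Ioi.mp h) 2⟩
      refine ⟨fun δ => w (δ ^ 2) * rot (-θ), (hw.comp hsq).mul_const _, ?_⟩
      filter_upwards [hsq.eventually hw'] with δ h
      convert h using 2
      simp only [σ, Sum.elim_inl]
      push_cast
      linear_combination (δ : ℂ) ^ 2 * w (δ ^ 2) * hab
    · have hσ2 : (Complex.I * (σ (Sum.inr b) : ℂ)) ^ 2 = -(lam / 2) := by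
        have : σ (Sum.inr b) ^ 2 = lam / 2 := by
          cases b <;> simp [σ, hs2]
        rw [mul_pow, Complex.I_sq, ← Complex.ofReal_pow, this]
        push_cast; ring
      have hσ0 : Complex.I * (σ (Sum.inr b) : ℂ) ≠ 0 := by
        refine mul_ne_zero Complex.I_ne_zero ?_
        cases b <;> simp [σ, hs0.ne']
      refine exists_root_order_half k hθ hk hσ0 hσ2 ?_
      generalize Complex.I * (σ (Sum.inr b) : ℂ) = x at hσ2 hσ0
      have hI : (lam : ℂ) / (2 * Complex.I) = -(Complex.I * (lam / 2)) := by
        field_simp; simp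
      rw [hI]
      simp only [T, Sum.elim_inr]
      -- For k = 0 no block precedes the leading one; otherwise the power of 0 keeps only the
      -- summand p = n.
      rcases k with _ | n
      · simp only [if_true] at ht
        simp only [Finset.range_zero, Finset.sum_empty]
        refine mul_left_cancel₀ ha0 ?_
        linear_combination x * ht
      · have hsum : ∑ p ∈ Finset.range (n + 1),
            blockGain c p * rot θ ^ p * 0 ^ (n + 1 - 1 - p) * x ^ p =
            blockGain c n * rot θ ^ n * x ^ n := by
          rw [Finset.sum_range_succ, Finset.sum_eq_zero]
          · simp
          · intro p hp
            have := Finset.mem_range.mp hp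
            rw [zero_pow (by omega)]; ring
        rw [hsum]
        simp only [Nat.add_eq_zero_iff, one_ne_zero, and_false, if_false, Nat.add_sub_cancel] at ht
        linear_combination rot θ ^ n * x ^ (n + 2) * ht -
          Complex.I * blockGain c n * rot θ ^ n * x ^ n * hσ2
  choose w hw hroot using hex
  have hinjσT : Function.Injective fun i => (σ i, T i) := by
    rintro (n | b) (n' | b') h
    · simp only [T, Sum.elim_inl, Prod.mk.injEq] at h
      have hb0 := rot_ne_zero (-θ)
      rw [hinj (mul_right_cancel₀ hb0 h.2)]
    · exfalso
      cases b' <;> simp [σ] at h <;> linarith [h.1]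
    · exfalso
      cases b <;> simp [σ] at h <;> linarith [h.1]
    · cases b <;> cases b' <;> simp [σ] at h ⊢ <;> linarith [h.1]
  refine closedLoop_asymptotics (by omega) hθ (by simp) hinjσT hw hroot ?_
  convert hμ using 3 with i
  rcases i with n | b
  · simp [σ, T]
  · have : σ (Sum.inr b) ^ 2 = lam / 2 := by
      cases b <;> simp [σ, hs2]
    rw [this]
    simp only [T, Sum.elim_inr]
    ring

/-! ### Translation into the real constants, R and H. -/

lemma rot_neg_eq_exp (θ : ℝ) : Complex.exp (-(θ * Complex.I)) = rot (-θ) := by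
  simp [rot]

lemma rot_sq (θ : ℝ) : rot θ ^ 2 = rot (2 * θ) := by
  rw [rot, rot, ← Complex.exp_nat_mul]
  congr 1; push_cast; ring

/-- The phase i e^{2iθ} makes s² real and negative, so that the two zeros of order √ε start
tangentially to the unit circle. -/
lemma blockGain_eq_of_leading {c : ℕ → ℝ} {k : ℕ} {θ : ℝ}
    (h1 : c (2 * k + 1) = -Real.sin (2 * θ)) (h2 : c (2 * k + 2) = Real.cos (2 * θ)) :
    blockGain c k = Complex.I * rot θ ^ 2 := by
  rw [rot_sq, rot_eq, blockGain, h1, h2, Complex.ofReal_neg]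
  linear_combination -(Real.sin (2 * θ) : ℂ) * Complex.I_sq

lemma aux_eq (k : ℕ) (c : ℕ → ℝ) (z : ℂ) :
    aux (k + 2) c z =
      -Complex.I * ∑ p ∈ Finset.range (k + 1), blockGain c p * z ^ p := by
  rw [aux, show k + 2 - 1 = k + 1 by omega, ← Finset.Ico_add_one_right_eq_Icc,
    Finset.sum_Ico_eq_sum_range, Finset.mul_sum]
  refine Finset.sum_congr (by simp) fun p _ => ?_
  rw [show 1 + p - 1 = p by omega, show 2 * (1 + p) - 1 = 2 * p + 1 by omega,
    show 2 * (1 + p) = 2 * p + 2 by omega, blockGain]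
  linear_combination z ^ p * (c (2 * p + 2) : ℂ) * Complex.I_sq

/-- This is the last block's share of Re t; the curvature term λ/4 accounts for the constant 1/2 in
R. -/
lemma re_topGain (k : ℕ) (θ lam : ℝ) (c : ℕ → ℝ) :
    (Complex.I * (lam / 4) * blockGain c (k + 1) * rot (-θ)).re + lam / 4 =
      1 / 2 * (lam * R (k + 2) θ c) := by
  rw [R, show 2 * (k + 2) - 1 = 2 * (k + 1) + 1 by omega,
    show 2 * (k + 2) = 2 * (k + 1) + 2 by omega, rot_neg_eq, blockGain,
    show (lam : ℂ) / 4 = ((lam / 4 : ℝ) : ℂ) by push_cast; rfl]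
  simp [-Complex.ofReal_cos, -Complex.ofReal_sin, -Complex.ofReal_div]
  ring

/-- The denominator in H is -e^{2iθ} by the choice of the leading gain. The term enters t with a
minus sign and so contributes H/2. -/
lemma re_prevGain {n : ℕ} {θ : ℝ} {c : ℕ → ℝ}
    (hk : blockGain c (n + 1) = Complex.I * rot θ ^ 2) :
    (Complex.I / 2 * blockGain c n * rot (-θ) ^ 3).re = -(1 / 2 * H (n + 3) θ c) := by
  have hab := rot_mul_rot_neg θ
  have ha0 := rot_ne_zero θ
  have h1 : (c (2 * (n + 3) - 5) : ℂ) * Complex.I - (c (2 * (n + 3) - 4) : ℂ) =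
      Complex.I * blockGain c n := by
    rw [show 2 * (n + 3) - 5 = 2 * n + 1 by omega, show 2 * (n + 3) - 4 = 2 * n + 2 by omega,
      blockGain]
    linear_combination -(c (2 * n + 2) : ℂ) * Complex.I_sq
  have h2 : (c (2 * (n + 3) - 3) : ℂ) * Complex.I - (c (2 * (n + 3) - 2) : ℂ) =
      -rot θ ^ 2 := by
    rw [show 2 * (n + 3) - 3 = 2 * (n + 1) + 1 by omega,
      show 2 * (n + 3) - 2 = 2 * (n + 1) + 2 by omega]
    rw [blockGain] at hk
    linear_combination Complex.I * hk +
      (rot θ ^ 2 - (c (2 * (n + 1) + 2) : ℂ)) * Complex.I_sq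
  have h3 : Complex.I / 2 * blockGain c n * rot (-θ) ^ 3 =
      ((-(1 / 2) : ℝ) : ℂ) * (Complex.I * blockGain c n / -rot θ ^ 2 * rot (-θ)) := by
    rw [eq_div_of_mul_eq ha0 ((mul_comm _ _).trans hab)]
    push_cast
    field_simp
  rw [H, rot_neg_eq_exp, h1, h2, h3, Complex.re_ofReal_mul]
  ring

theorem asymptotics_two {θ lam : ℝ} (hθ : Real.sin θ ≠ 0) (hlam : 0 < lam) {c : ℕ → ℝ}
    (hc : CondTwo θ c) :
    (∀ᶠ ε in 𝓝[>] (0 : ℝ), StableDistinct 2 θ lam c ε) ∧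
      (fun ε : ℝ => (rho 2 θ lam c ε).toReal - (1 + 1 / 2 * (lam * R 2 θ c) * ε))
        =o[𝓝[>] 0] fun ε : ℝ => ε := by
  obtain ⟨h1, h2, hR⟩ := hc
  have hab := rot_mul_rot_neg θ
  have hk : blockGain c 0 = Complex.I * rot θ ^ 2 := blockGain_eq_of_leading h1 h2
  have h := closedLoop_asymptotics_of_roots 0 hθ hlam hk (ϑ := Fin.elim0)
    (fun i => i.elim0) (fun i => i.elim0)
    (t := Complex.I * (lam / 4) * blockGain c (0 + 1) * rot (-θ))
    (μ := 1 / 2 * (lam * R 2 θ c))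
    (by
      simp only [if_true]
      linear_combination Complex.I * (lam / 2) * blockGain c (0 + 1) * rot θ ^ 2 * hab)
    (by
      refine ⟨⟨Sum.inr true, re_topGain 0 θ lam c⟩, ?_⟩
      rintro _ ⟨i | b, rfl⟩
      · exact i.elim0
      · exact (re_topGain 0 θ lam c).le)
  exact ⟨h.1 (by nlinarith [mul_neg_of_pos_of_neg hlam hR]), h.2⟩

theorem asymptotics_ge_three {m : ℕ} (h3 : 3 ≤ m) {θ lam : ℝ} (hθ : Real.sin θ ≠ 0)
    (hlam : 0 < lam) {c : ℕ → ℝ} {ϑ : ℕ → ℂ} (hc : CondGeThree m θ lam c ϑ) :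
    (∀ᶠ ε in 𝓝[>] (0 : ℝ), StableDistinct m θ lam c ε) ∧
      (fun ε : ℝ => (rho m θ lam c ε).toReal -
          (1 + 1 / 2 * ((Finset.Icc 3 m).sup' (Finset.nonempty_Icc.mpr h3) fun n =>
              max (lam * R m θ c + H m θ c)
                (2 * (ϑ n * Complex.exp (-(θ * Complex.I))).re)) * ε))
        =o[𝓝[>] 0] fun ε : ℝ => ε := by
  obtain ⟨n, rfl⟩ : ∃ n, m = n + 3 := ⟨m - 3, by omega⟩
  obtain ⟨h1, h2, hinj, hroot, hRH, hre⟩ := hc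
  have hab := rot_mul_rot_neg θ
  rw [show 2 * (n + 3) - 3 = 2 * (n + 1) + 1 by omega] at h1
  rw [show 2 * (n + 3) - 2 = 2 * (n + 1) + 2 by omega] at h2
  have hk := blockGain_eq_of_leading h1 h2
  have hmem : ∀ i : Fin (n + 1), (i : ℕ) + 3 ∈ Set.Icc 3 (n + 3) := fun i => ⟨by omega, by omega⟩
  simp only [rot_neg_eq_exp] at hre ⊢
  have htre : (Complex.I * (lam / 4) * blockGain c (n + 1 + 1) * rot (-θ) -
      Complex.I / 2 * blockGain c n * rot (-θ) ^ 3).re + lam / 4 =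
      1 / 2 * (lam * R (n + 3) θ c + H (n + 3) θ c) := by
    have e1 : _ = 1 / 2 * (lam * R (n + 3) θ c) := re_topGain (n + 1) θ lam c
    have e2 := re_prevGain hk
    rw [Complex.sub_re]
    linarith
  have h := closedLoop_asymptotics_of_roots (n + 1) hθ hlam hk
    (ϑ := fun i => ϑ (i + 3)) (fun i j hij => by
      have := hinj (hmem i) (hmem j) hij
      exact Fin.ext (by omega))
    (fun i => by
      have := hroot _ (hmem i)
      rw [show n + 3 = n + 1 + 2 by omega, aux_eq] at this
      exact (mul_eq_zero.mp this).resolve_left (by simp))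
    (t := Complex.I * (lam / 4) * blockGain c (n + 1 + 1) * rot (-θ) -
      Complex.I / 2 * blockGain c n * rot (-θ) ^ 3)
    (μ := 1 / 2 * ((Finset.Icc 3 (n + 3)).sup' (Finset.nonempty_Icc.mpr h3) fun n' =>
              max (lam * R (n + 3) θ c + H (n + 3) θ c) (2 * (ϑ n' * rot (-θ)).re)))
    (by
      have hab3 : rot θ ^ 3 * rot (-θ) ^ 3 = 1 := by rw [← mul_pow, hab, one_pow]
      simp only [Nat.add_eq_zero_iff, one_ne_zero, and_false, if_false, Nat.add_sub_cancel]
      linear_combination Complex.I * (lam / 2) * blockGain c (n + 1 + 1) * rot θ ^ 2 * hab -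
        Complex.I * blockGain c n * hab3)
    (by
      constructor
      · obtain ⟨j, hj, hj'⟩ := Finset.exists_mem_eq_sup' (Finset.nonempty_Icc.mpr h3) fun n' =>
          max (lam * R (n + 3) θ c + H (n + 3) θ c) (2 * (ϑ n' * rot (-θ)).re)
        rw [hj']
        rw [Finset.mem_Icc] at hj
        rcases max_choice (lam * R (n + 3) θ c + H (n + 3) θ c) (2 * (ϑ j * rot (-θ)).re)
          with hm | hm
        · exact ⟨Sum.inr true, by rw [hm]; exact htre⟩
        · refine ⟨Sum.inl ⟨j - 3, by omega⟩, ?_⟩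
          rw [hm]
          simp only [Sum.elim_inl]
          rw [show j - 3 + 3 = j by omega]
          ring
      · have hle := fun j hj => Finset.le_sup' (s := Finset.Icc 3 (n + 3)) (fun n' =>
          max (lam * R (n + 3) θ c + H (n + 3) θ c) (2 * (ϑ n' * rot (-θ)).re)) (b := j) hj
        rintro _ ⟨i | b, rfl⟩
        · have e1 := hle (i + 3) (Finset.mem_Icc.mpr (hmem i))
          have e2 := (le_max_right _ _).trans e1
          simp only [Sum.elim_inl]
          linarith
        · have e1 := hle 3 (Finset.mem_Icc.mpr ⟨le_rfl, h3⟩)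
          have e2 := (le_max_left _ _).trans e1
          simp only [Sum.elim_inr]
          rw [htre]
          linarith)
  refine ⟨h.1 ?_, h.2⟩
  have : (Finset.Icc 3 (n + 3)).sup' (Finset.nonempty_Icc.mpr h3) (fun n' =>
      max (lam * R (n + 3) θ c + H (n + 3) θ c) (2 * (ϑ n' * rot (-θ)).re)) < 0 :=
    (Finset.sup'_lt_iff _).mpr fun j hj =>
      max_lt hRH (by linarith [hre j (Finset.mem_Icc.mp hj)])
  linarith

/-! ### Existence of admissible constants. -/

/-- Real constants with prescribed complex block gains. -/
lemma exists_blockGain_eq (g : ℕ → ℂ) : ∃ c : ℕ → ℝ, ∀ p, blockGain c p = g p ∧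
    c (2 * p + 1) = (g p).re ∧ c (2 * p + 2) = (g p).im := by
  let c : ℕ → ℝ := fun i => if i % 2 = 1 then (g (i / 2)).re else (g (i / 2 - 1)).im
  have h1 : ∀ p, c (2 * p + 1) = (g p).re := fun p => by
    simp only [c]
    rw [if_pos (by omega), show (2 * p + 1) / 2 = p by omega]
  have h2 : ∀ p, c (2 * p + 2) = (g p).im := fun p => by
    simp only [c]
    rw [if_neg (by omega), show (2 * p + 2) / 2 - 1 = p by omega]
  exact ⟨c, fun p => ⟨by rw [blockGain, h1, h2, Complex.re_add_im], h1 p, h2 p⟩⟩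

lemma exists_pos_forall_lt_mul {N : ℕ} {lam : Fin N → ℝ} (hlam : ∀ i, 0 < lam i) (h : ℝ) :
    ∃ τ > 0, ∀ i, h < lam i * τ := by
  have hnn : ∀ i, 0 ≤ |h| / lam i := fun i => div_nonneg (abs_nonneg h) (hlam i).le
  -- A sum in place of a maximum also covers the empty family.
  refine ⟨1 + ∑ i, |h| / lam i, by
    have := Finset.sum_nonneg fun i (_ : i ∈ Finset.univ) => hnn i
    linarith, fun i => ?_⟩
  have h1 := Finset.single_le_sum (fun i _ => hnn i) (Finset.mem_univ i)
  have h2 := mul_le_mul_of_nonneg_left h1 (hlam i).le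
  rw [mul_div_cancel₀ _ (hlam i).ne'] at h2
  linarith [le_abs_self h, hlam i]

/-- The gain (1 + 2τ) i e^{iθ} in the last block gives free control of R. -/
lemma topGain_R {k : ℕ} {θ τ : ℝ} {c : ℕ → ℝ}
    (h1 : c (2 * (k + 1) + 1) = -(1 + 2 * τ) * Real.sin θ)
    (h2 : c (2 * (k + 1) + 2) = (1 + 2 * τ) * Real.cos θ) : R (k + 2) θ c = -τ := by
  rw [R, show 2 * (k + 2) - 1 = 2 * (k + 1) + 1 by omega,
    show 2 * (k + 2) = 2 * (k + 1) + 2 by omega, h1, h2]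
  linear_combination -(1 / 2) * (1 + 2 * τ) * Real.sin_sq_add_cos_sq θ

/-- Constants that meet the requirements exist for `m = 2`. -/
lemma exists_condTwo (θ : ℝ) : ∃ c : ℕ → ℝ, CondTwo θ c := by
  obtain ⟨c, hc⟩ := exists_blockGain_eq fun p => if p = 0
    then ⟨-Real.sin (2 * θ), Real.cos (2 * θ)⟩
    else ⟨-(1 + 2 * 1) * Real.sin θ, (1 + 2 * 1) * Real.cos θ⟩
  refine ⟨c, (hc 0).2.1, (hc 0).2.2, ?_⟩
  rw [topGain_R (k := 0) (hc 1).2.1 (hc 1).2.2]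
  norm_num

/-- Constants that meet the requirements exist for `m ≥ 3`. -/
lemma exists_condGeThree (n : ℕ) (θ : ℝ) {N : ℕ} {lam : Fin N → ℝ} (hlam : ∀ i, 0 < lam i) :
    ∃ (c : ℕ → ℝ) (ϑ : ℕ → ℂ), ∀ i, CondGeThree (n + 3) θ (lam i) c ϑ := by
  have hab := rot_mul_rot_neg θ
  -- After multiplication by e^{-iθ} these roots become the negative reals -j.
  let ϑ : ℕ → ℂ := fun j => -(j : ℂ) * rot θ
  let P : Polynomial ℂ := Polynomial.C (Complex.I * rot θ ^ 2) *
    ∏ j ∈ Finset.Icc 3 (n + 3), (Polynomial.X - Polynomial.C (ϑ j))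
  have hmonic : (∏ j ∈ Finset.Icc 3 (n + 3), (Polynomial.X - Polynomial.C (ϑ j))).Monic :=
    Polynomial.monic_prod_of_monic _ _ fun j _ => Polynomial.monic_X_sub_C _
  have hdeg : (∏ j ∈ Finset.Icc 3 (n + 3),
      (Polynomial.X - Polynomial.C (ϑ j))).natDegree = n + 1 := by
    rw [Polynomial.natDegree_prod_of_monic _ _ fun j _ => Polynomial.monic_X_sub_C _]
    simp
  have hPdeg : P.natDegree < n + 2 :=
    (Polynomial.natDegree_C_mul_le _ _).trans_lt (by omega)
  have hPlead : P.coeff (n + 1) = Complex.I * rot θ ^ 2 := by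
    have h1 := hmonic.coeff_natDegree
    rw [hdeg] at h1
    simp only [P, Polynomial.coeff_C_mul, h1, mul_one]
  have hlead : Complex.I * rot θ ^ 2 = ⟨-Real.sin (2 * θ), Real.cos (2 * θ)⟩ := by
    rw [rot_sq, rot_eq]
    apply Complex.ext <;> simp [-Complex.ofReal_cos, -Complex.ofReal_sin]
  -- The value of H depends only on the coefficients of `P`, so τ can be chosen afterwards with λ_i
  -- τ > H for every i.
  let h : ℝ := -2 * (Complex.I / 2 * P.coeff n * rot (-θ) ^ 3).re
  obtain ⟨τ, hτ, hτ'⟩ := exists_pos_forall_lt_mul hlam h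
  obtain ⟨c, hc⟩ := exists_blockGain_eq fun p => if p < n + 2 then P.coeff p
    else ⟨-(1 + 2 * τ) * Real.sin θ, (1 + 2 * τ) * Real.cos θ⟩
  have hk := (hc (n + 1))
  rw [if_pos (by omega), hPlead] at hk
  have hR : R (n + 3) θ c = -τ := by
    have := hc (n + 1 + 1)
    rw [if_neg (by omega)] at this
    exact topGain_R this.2.1 this.2.2
  have hH : H (n + 3) θ c = h := by
    have h1 := re_prevGain hk.1
    have h2 := (hc n).1
    rw [if_pos (by omega)] at h2
    rw [h2] at h1
    simp only [h]
    linarith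
  refine ⟨c, ϑ, fun i => ⟨?_, ?_, ?_, ?_, ?_, ?_⟩⟩
  · rw [show 2 * (n + 3) - 3 = 2 * (n + 1) + 1 by omega, hk.2.1, hlead]
  · rw [show 2 * (n + 3) - 2 = 2 * (n + 1) + 2 by omega, hk.2.2, hlead]
  · intro j _ j' _ hjj
    have := mul_right_cancel₀ (rot_ne_zero θ) hjj
    exact_mod_cast neg_injective this
  · intro j hj
    rw [show n + 3 = n + 1 + 2 by omega, aux_eq]
    have h1 : ∑ p ∈ Finset.range (n + 1 + 1), blockGain c p * ϑ j ^ p = P.eval (ϑ j) := by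
      rw [Polynomial.eval_eq_sum_range' hPdeg]
      refine Finset.sum_congr rfl fun p hp => ?_
      rw [(hc p).1, if_pos (Finset.mem_range.mp hp)]
    rw [h1]
    simp only [P, Polynomial.eval_mul, Polynomial.eval_prod]
    rw [Finset.prod_eq_zero (Finset.mem_Icc.mpr hj) (by simp)]
    ring
  · rw [hR, hH]
    linarith [hτ' i]
  · intro j hj
    rw [rot_neg_eq_exp, show ϑ j * rot (-θ) = ((-(j : ℝ) : ℝ) : ℂ) by
      push_cast; simp only [ϑ]; linear_combination -(j : ℂ) * hab, Complex.ofReal_re]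
    have : (3 : ℝ) ≤ j := by exact_mod_cast hj.1
    linarith

end Oscillator

end

theorem mainTheorem3 (m : ℕ) (hm : 2 ≤ m) (θ : ℝ) (hθ : Real.sin θ ≠ 0) :
    -- suitable constants exist, simultaneously for any finite family of positive `lam i`
    (∀ (N : ℕ) (lam : Fin N → ℝ), (∀ i, 0 < lam i) →
      ∃ c : ℕ → ℝ,
        (m = 2 → Oscillator.CondTwo θ c) ∧
        (3 ≤ m → ∃ ϑ : ℕ → ℂ, ∀ i, Oscillator.CondGeThree m θ (lam i) c ϑ) ∧
        ∀ᶠ ε in 𝓝[>] (0 : ℝ), ∀ i, Oscillator.StableDistinct m θ (lam i) c ε) ∧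
    -- the case `m = 2`
    (m = 2 → ∀ (lam : ℝ) (c : ℕ → ℝ), 0 < lam → Oscillator.CondTwo θ c →
      (∀ᶠ ε in 𝓝[>] (0 : ℝ), Oscillator.StableDistinct m θ lam c ε) ∧
      (fun ε : ℝ => (Oscillator.rho m θ lam c ε).toReal -
          (1 + 1 / 2 * (lam * Oscillator.R m θ c) * ε))
        =o[𝓝[>] 0] fun ε : ℝ => ε) ∧
    -- the case `m ≥ 3`
    (∀ h3 : 3 ≤ m, ∀ (lam : ℝ) (c : ℕ → ℝ) (ϑ : ℕ → ℂ), 0 < lam →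
      Oscillator.CondGeThree m θ lam c ϑ →
      (∀ᶠ ε in 𝓝[>] (0 : ℝ), Oscillator.StableDistinct m θ lam c ε) ∧
      (fun ε : ℝ => (Oscillator.rho m θ lam c ε).toReal -
          (1 + 1 / 2 * ((Finset.Icc 3 m).sup' (Finset.nonempty_Icc.mpr h3) fun n =>
              max (lam * Oscillator.R m θ c + Oscillator.H m θ c)
                (2 * (ϑ n * Complex.exp (-(θ * Complex.I))).re)) * ε))
        =o[𝓝[>] 0] fun ε : ℝ => ε) := by
  refine ⟨fun N lam hlam => ?_, fun h2 lam c hlam hc => ?_, fun h3 lam c ϑ hlam hc =>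
    Oscillator.asymptotics_ge_three h3 hθ hlam hc⟩
  · obtain rfl | h3 : m = 2 ∨ 3 ≤ m := by omega
    · obtain ⟨c, hc⟩ := Oscillator.exists_condTwo θ
      exact ⟨c, fun _ => hc, fun h => absurd h (by norm_num), eventually_all.mpr fun i =>
        (Oscillator.asymptotics_two hθ (hlam i) hc).1⟩
    · obtain ⟨n, rfl⟩ : ∃ n, m = n + 3 := ⟨m - 3, by omega⟩
      obtain ⟨c, ϑ, hc⟩ := Oscillator.exists_condGeThree n θ hlam
      exact ⟨c, fun h => absurd h (by omega), fun _ => ⟨ϑ, hc⟩, eventually_all.mpr fun i =>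
        (Oscillator.asymptotics_ge_three h3 hθ (hlam i) (hc i)).1⟩
  · subst h2
    exact Oscillator.asymptotics_two hθ hlam hc
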